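/- Let $k$ be a field of characteristic zero and let $n \ge 2$ be an integer. For $m \ge 0$ let $V_m = k[x,y]_m$ be the space of binary forms of degree $m$ over $k$, and let $f_n = \sum_{i=0}^{n} a_i x^i y^{n-i}$ and $f_{n-2} = \sum_{j=0}^{n-2} b_j x^j y^{n-2-j}$ be the generic forms of degrees $n$ and $n-2$, so that $k[V_n \times V_{n-2}] = k[a_0,\dots,a_n,b_0,\dots,b_{n-2}]$. Let $\mathrm{res}$ be the resultant of two binary forms of degree $n$ (the determinant of the $2n\times 2n$ Sylvester matrix of their coefficients, with the sign for which $\mathrm{res}\bigl(\prod_i(\alpha_{i,0}x-\alpha_{i,1}y),\prod_j(\beta_{j,0}x-\beta_{j,1}y)\bigr)=\prod_{i,j}(\alpha_{i,0}\beta_{j,1}-\beta_{j,0}\alpha_{i,1})$). The discriminant-resultants $DR_{n,r} \in k[V_n\times V_{n-2}]$, $0 \le r \le n$, are the polynomials determined by the identity in $k[V_n \times V_{n-2}][t]$ $$\sum_{r=0}^{n} DR_{n,r}\, t^r = \frac{\mathrm{res}\bigl(f_n,\; x\,\partial_x f_n + t\,x y\, f_{n-2}\bigr)}{a_0 a_n}.$$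 Then the $n$ polynomials $DR_{n,0}, DR_{n,2}, DR_{n,3}, \dots, DR_{n,n}$ are algebraically independent over $k$. -/

import Mathlib

namespace BinaryForms

/-- The binary form `∑ i, c_i x^i y^(m-i)` of degree `m` with coefficients `c_0, …, c_m`
(the variable `X 0` is `x` and the variable `X 1` is `y`). -/
noncomputable def form {R : Type*} [CommRing R] (m : ℕ) (c : Fin (m + 1) → R) :
    MvPolynomial (Fin 2) R :=
  ∑ i : Fin (m + 1),
    MvPolynomial.C (c i) * MvPolynomial.X 0 ^ (i : ℕ) * MvPolynomial.X 1 ^ (m - (i : ℕ))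

/-- The dehomogenization `F(x, 1)` of a binary form `F(x, y)`. -/
noncomputable def dehom {R : Type*} [CommRing R] (F : MvPolynomial (Fin 2) R) : Polynomial R :=
  MvPolynomial.aeval ![Polynomial.X, 1] F

/-- The resultant of binary forms `F`, `G` of degrees `d`, `e`: the determinant of the
`(d + e) × (d + e)` Sylvester matrix of their coefficients, with the sign for which
`res (∏ i, (α_{i,0} x - α_{i,1} y)) (∏ j, (β_{j,0} x - β_{j,1} y))`
is `∏ i, ∏ j, (α_{i,0} β_{j,1} - β_{j,0} α_{i,1})`. The sizes `d`, `e` are prescribed, so leading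
coefficients may vanish. -/
noncomputable def res {R : Type*} [CommRing R] (d e : ℕ) (F G : MvPolynomial (Fin 2) R) : R :=
  (-1) ^ (d * e) * Polynomial.resultant (dehom F) (dehom G) d e

/-- Index set of the coordinates `a_0, …, a_n` on `V_n` and `b_0, …, b_{n-2}` on `V_{n-2}`. -/
abbrev Coord (n : ℕ) : Type := Fin (n + 1) ⊕ Fin (n - 2 + 1)

/-- The ring `k[V_n × V_{n-2}]` of regular functions on pairs of binary forms. -/
abbrev CoordRing (k : Type*) [Field k] (n : ℕ) : Type _ := MvPolynomial (Coord n) k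

/-- The coordinate `a_i`. -/
noncomputable def a (k : Type*) [Field k] (n : ℕ) (i : Fin (n + 1)) : CoordRing k n :=
  MvPolynomial.X (Sum.inl i)

/-- The coordinate `b_j`. -/
noncomputable def b (k : Type*) [Field k] (n : ℕ) (j : Fin (n - 2 + 1)) : CoordRing k n :=
  MvPolynomial.X (Sum.inr j)

/-- The generic form `f_n`, with coefficients in `k[V_n × V_{n-2}][t]`. -/
noncomputable def genF (k : Type*) [Field k] (n : ℕ) :
    MvPolynomial (Fin 2) (Polynomial (CoordRing k n)) :=
  form n fun i => Polynomial.C (a k n i)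

/-- The generic form `f_{n-2}`, with coefficients in `k[V_n × V_{n-2}][t]`. -/
noncomputable def genG (k : Type*) [Field k] (n : ℕ) :
    MvPolynomial (Fin 2) (Polynomial (CoordRing k n)) :=
  form (n - 2) fun j => Polynomial.C (b k n j)

/-- The form `x ∂f_n/∂x + t x y f_{n-2}` of degree `n`. -/
noncomputable def deformation (k : Type*) [Field k] (n : ℕ) :
    MvPolynomial (Fin 2) (Polynomial (CoordRing k n)) :=
  MvPolynomial.X 0 * MvPolynomial.pderiv 0 (genF k n) +
    MvPolynomial.C Polynomial.X * MvPolynomial.X 0 * MvPolynomial.X 1 * genG k n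

/-- The polynomial `res (f_n, x ∂f_n/∂x + t x y f_{n-2})` in `t`. -/
noncomputable def totalRes (k : Type*) [Field k] (n : ℕ) : Polynomial (CoordRing k n) :=
  res n n (genF k n) (deformation k n)

/-- The discriminant-resultant `DR_{n,r}`: the coefficient of `t^r` in
`res (f_n, x ∂f_n/∂x + t x y f_{n-2}) / (a_0 a_n)`. The division by the monomial `a_0 a_n` is exact,
see `sum_discriminantResultant`. -/
noncomputable def discriminantResultant (k : Type*) [Field k] (n r : ℕ) : CoordRing k n :=
  ((totalRes k n).coeff r).divMonomial
    (Finsupp.single (Sum.inl 0) 1 + Finsupp.single (Sum.inl (Fin.last n)) 1)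

/-! The defining identity of the discriminant-resultants. -/

lemma dehom_form {R : Type*} [CommRing R] (m : ℕ) (c : Fin (m + 1) → R) :
    dehom (form m c) = ∑ i : Fin (m + 1), Polynomial.C (c i) * Polynomial.X ^ (i : ℕ) := by
  simp [dehom, form, Polynomial.C_eq_algebraMap]

lemma dehom_pderiv {R : Type*} [CommRing R] (F : MvPolynomial (Fin 2) R) :
    dehom (MvPolynomial.pderiv 0 F) = Polynomial.derivative (dehom F) := by
  induction F using MvPolynomial.induction_on with
  | C r => simp [dehom]
  | add p q hp hq => simp_all [dehom]
  | mul_X p i hp =>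
    fin_cases i
    all_goals simp_all [dehom, Derivation.leibniz, MvPolynomial.pderiv_X]
    ring

/-- The dehomogenization of `(x ∂f_n/∂x + t x y f_{n-2}) / x`. -/
noncomputable def cofactor (k : Type*) [Field k] (n : ℕ) :
    Polynomial (Polynomial (CoordRing k n)) :=
  Polynomial.derivative (dehom (genF k n)) + Polynomial.C Polynomial.X * dehom (genG k n)

lemma dehom_deformation (k : Type*) [Field k] (n : ℕ) :
    dehom (deformation k n) = cofactor k n * Polynomial.X := by
  rw [cofactor, ← dehom_pderiv]
  simp [deformation, dehom, Polynomial.C_eq_algebraMap]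
  ring

lemma natDegree_dehom_form {R : Type*} [CommRing R] (m : ℕ) (c : Fin (m + 1) → R) :
    (dehom (form m c)).natDegree ≤ m := by
  rw [dehom_form]
  refine Polynomial.natDegree_sum_le_of_forall_le _ _ fun i _ => ?_
  exact (Polynomial.natDegree_C_mul_X_pow_le _ _).trans (by omega)

lemma coeff_dehom_form {R : Type*} [CommRing R] (m : ℕ) (c : Fin (m + 1) → R) (i : Fin (m + 1)) :
    (dehom (form m c)).coeff i = c i := by
  rw [dehom_form]
  simp only [Polynomial.finsetSum_coeff, Polynomial.coeff_C_mul_X_pow]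
  simp [Fin.val_inj]

lemma natDegree_cofactor (k : Type*) [Field k] (n : ℕ) (hn : 2 ≤ n) :
    (cofactor k n).natDegree ≤ n - 1 := by
  refine Polynomial.natDegree_add_le_of_degree_le ?_ ?_
  · exact (Polynomial.natDegree_derivative_le _).trans
      (Nat.sub_le_sub_right (natDegree_dehom_form _ _) 1)
  · refine (Polynomial.natDegree_C_mul_le _ _).trans ((natDegree_dehom_form _ _).trans ?_)
    omega

lemma dvd_resultant {R : Type*} [CommRing R] (c : R) (f g : Polynomial R) (m n : ℕ)
    (hm : 0 < m) (hn : 0 < n) (hf : f.natDegree ≤ m) (hg : g.natDegree ≤ n)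
    (hfc : c ∣ f.coeff m) (hgc : c ∣ g.coeff n) : c ∣ Polynomial.resultant f g m n := by
  have aux : ∀ (p : Polynomial R) (m : ℕ), 0 < m → p.natDegree ≤ m → c ∣ p.coeff m →
      (p.map (Ideal.Quotient.mk (Ideal.span {c}))).natDegree < m := by
    intro p m hm hp h
    refine lt_of_le_of_ne (Polynomial.natDegree_map_le.trans hp) fun h' => ?_
    have h2 : (p.map (Ideal.Quotient.mk (Ideal.span {c}))).leadingCoeff = 0 := by
      rw [Polynomial.leadingCoeff, h', Polynomial.coeff_map, Ideal.Quotient.eq_zero_iff_mem,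
        Ideal.mem_span_singleton]
      exact h
    rw [Polynomial.leadingCoeff_eq_zero] at h2
    rw [h2, Polynomial.natDegree_zero] at h'
    omega
  rw [← Ideal.mem_span_singleton, ← Ideal.Quotient.eq_zero_iff_mem,
    ← Polynomial.resultant_map_map]
  exact Polynomial.resultant_eq_zero_of_lt_lt _ _ _ _ (aux f m hm hf hfc) (aux g n hn hg hgc)

lemma C_a_last_dvd_resultant_cofactor (k : Type*) [Field k] (n : ℕ) (hn : 2 ≤ n) :
    Polynomial.C (a k n (Fin.last n)) ∣
      Polynomial.resultant (dehom (genF k n)) (cofactor k n) n (n - 1) := by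
  have hc : (dehom (genF k n)).coeff n = Polynomial.C (a k n (Fin.last n)) :=
    coeff_dehom_form n (fun i => Polynomial.C (a k n i)) (Fin.last n)
  have hg : (dehom (genG k n)).coeff (n - 1) = 0 :=
    Polynomial.coeff_eq_zero_of_natDegree_lt
      (lt_of_le_of_lt (natDegree_dehom_form _ _) (by omega))
  refine dvd_resultant _ _ _ _ _ (by omega) (by omega) (natDegree_dehom_form _ _)
    (natDegree_cofactor k n hn) (by rw [hc]) ?_
  rw [cofactor, Polynomial.coeff_add, Polynomial.coeff_C_mul, hg, Polynomial.coeff_derivative,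
    show n - 1 + 1 = n by omega, hc, mul_zero, add_zero]
  exact dvd_mul_right _ _

lemma C_mul_dvd_totalRes (k : Type*) [Field k] (n : ℕ) (hn : 2 ≤ n) :
    Polynomial.C (a k n 0 * a k n (Fin.last n)) ∣ totalRes k n := by
  have h1 : Polynomial.resultant (dehom (genF k n)) (dehom (deformation k n)) n n =
      Polynomial.resultant (dehom (genF k n)) (cofactor k n) n (n - 1) *
        Polynomial.resultant (dehom (genF k n)) Polynomial.X n 1 := by
    obtain ⟨c, hc⟩ := Nat.exists_eq_add_of_le (natDegree_cofactor k n hn)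
    have hF : (dehom (genF k n)).natDegree ≤ n := natDegree_dehom_form _ _
    have hmul := Polynomial.resultant_mul_right (dehom (genF k n)) (cofactor k n) Polynomial.X n hF
    rw [Polynomial.natDegree_X] at hmul
    have e1 := Polynomial.resultant_add_right_deg (dehom (genF k n)) (cofactor k n) n
      (cofactor k n).natDegree c le_rfl
    have e2 := Polynomial.resultant_add_right_deg (dehom (genF k n))
      (cofactor k n * Polynomial.X) n ((cofactor k n).natDegree + 1) c
      (Polynomial.natDegree_mul_le.trans (by simp))
    rw [← hc] at e1
    rw [show (cofactor k n).natDegree + 1 + c = n by omega] at e2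
    rw [dehom_deformation, e1, e2, hmul, mul_assoc]
  have h2 : Polynomial.resultant (dehom (genF k n)) Polynomial.X n 1 =
      (-1) ^ n * Polynomial.C (a k n 0) := by
    have h := Polynomial.resultant_X_sub_C_right (dehom (genF k n)) n 0 (natDegree_dehom_form _ _)
    have h0 : (dehom (genF k n)).coeff 0 = Polynomial.C (a k n 0) := by
      exact coeff_dehom_form n (fun i => Polynomial.C (a k n i)) 0
    rw [map_zero, sub_zero, ← Polynomial.coeff_zero_eq_eval_zero, h0] at h
    exact h
  rw [totalRes, res, h1, h2, mul_comm (a k n 0), map_mul]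
  exact Dvd.dvd.mul_left (mul_dvd_mul (C_a_last_dvd_resultant_cofactor k n hn)
    (dvd_mul_left _ _)) _

lemma natDegree_resultant_le {S : Type*} [CommRing S] (f g : Polynomial (Polynomial S)) (m n : ℕ)
    (hf : ∀ i, (f.coeff i).natDegree ≤ 0) (hg : ∀ i, (g.coeff i).natDegree ≤ 1) :
    (Polynomial.resultant f g m n).natDegree ≤ m := by
  rw [Polynomial.resultant, Matrix.det_apply]
  refine Polynomial.natDegree_sum_le_of_forall_le _ _ fun σ _ => ?_
  refine (Polynomial.natDegree_smul_le _ _).trans ?_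
  refine (Polynomial.natDegree_prod_le _ _).trans ?_
  rw [Fin.sum_univ_add]
  have h1 : ∑ j : Fin m, (Polynomial.sylvester f g m n (σ (Fin.castAdd n j))
      (Fin.castAdd n j)).natDegree ≤ ∑ j : Fin m, 1 := by
    refine Finset.sum_le_sum fun j _ => ?_
    simp only [Polynomial.sylvester, Matrix.of_apply, Fin.addCases_left]
    split_ifs
    · exact hg _
    · simp
  have h2 : ∑ j : Fin n, (Polynomial.sylvester f g m n (σ (Fin.natAdd m j))
      (Fin.natAdd m j)).natDegree ≤ ∑ j : Fin n, 0 := by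
    refine Finset.sum_le_sum fun j _ => ?_
    simp only [Polynomial.sylvester, Matrix.of_apply, Fin.addCases_right]
    split_ifs
    · exact hf _
    · simp
  simp only [Finset.sum_const, Finset.card_univ, Fintype.card_fin, smul_eq_mul, mul_one,
    mul_zero] at h1 h2
  exact add_le_add h1 h2

lemma natDegree_coeff_dehom_form {S : Type*} [CommRing S] (m : ℕ) (c : Fin (m + 1) → S) (i : ℕ) :
    ((dehom (form m fun j => Polynomial.C (c j))).coeff i).natDegree ≤ 0 := by
  rw [dehom_form, Polynomial.finsetSum_coeff]
  refine Polynomial.natDegree_sum_le_of_forall_le _ _ fun j _ => ?_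
  rw [Polynomial.coeff_C_mul_X_pow]
  split_ifs <;> simp

lemma natDegree_totalRes (k : Type*) [Field k] (n : ℕ) : (totalRes k n).natDegree ≤ n := by
  rw [totalRes, res]
  have hs : ((-1 : Polynomial (CoordRing k n)) ^ (n * n)) = Polynomial.C ((-1) ^ (n * n)) := by
    simp
  rw [hs]
  refine (Polynomial.natDegree_C_mul_le _ _).trans ?_
  refine natDegree_resultant_le _ _ _ _ (natDegree_coeff_dehom_form _ _) fun i => ?_
  rw [dehom_deformation]
  cases i with
  | zero => simp
  | succ i =>
    rw [Polynomial.coeff_mul_X, cofactor, Polynomial.coeff_add, Polynomial.coeff_derivative,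
      Polynomial.coeff_C_mul]
    refine Polynomial.natDegree_add_le_of_degree_le ?_ ?_
    · refine Polynomial.natDegree_mul_le.trans ?_
      have h := natDegree_coeff_dehom_form n (a k n) (i + 1)
      have h' : ((i : Polynomial (CoordRing k n)) + 1).natDegree ≤ 0 := by
        have := Polynomial.natDegree_natCast (R := CoordRing k n) (i + 1)
        push_cast at this
        omega
      exact (add_le_add h h').trans (by omega)
    · refine Polynomial.natDegree_mul_le.trans ?_
      have h := natDegree_coeff_dehom_form (n - 2) (b k n) i
      exact (add_le_add Polynomial.natDegree_X_le h).trans (by omega)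

/-- `a_0 a_n DR_{n,r}` is the coefficient of `t^r` in `res (f_n, x ∂f_n/∂x + t x y f_{n-2})`. -/
lemma mul_discriminantResultant (k : Type*) [Field k] (n r : ℕ) (hn : 2 ≤ n) :
    a k n 0 * a k n (Fin.last n) * discriminantResultant k n r = (totalRes k n).coeff r := by
  obtain ⟨q, hq⟩ := C_mul_dvd_totalRes k n hn
  have hm : a k n 0 * a k n (Fin.last n) = MvPolynomial.monomial
      (Finsupp.single (Sum.inl 0) 1 + Finsupp.single (Sum.inl (Fin.last n)) 1) (1 : k) := by
    rw [a, a, MvPolynomial.X, MvPolynomial.X, MvPolynomial.monomial_mul, one_mul]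
  rw [discriminantResultant, hq, Polynomial.coeff_C_mul, hm,
    MvPolynomial.divMonomial_monomial_mul]

/-- `a_0 a_n ∑ r, DR_{n,r} t^r = res (f_n, x ∂f_n/∂x + t x y f_{n-2})`, the sum being over
`0 ≤ r ≤ n`. -/
lemma sum_discriminantResultant (k : Type*) [Field k] (n : ℕ) (hn : 2 ≤ n) :
    Polynomial.C (a k n 0 * a k n (Fin.last n)) *
      ∑ r ∈ Finset.range (n + 1),
        Polynomial.C (discriminantResultant k n r) * Polynomial.X ^ r = totalRes k n := by
  conv_rhs => rw [(totalRes k n).as_sum_range_C_mul_X_pow'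
    (Nat.lt_succ_of_le (natDegree_totalRes k n))]
  rw [Finset.mul_sum]
  refine Finset.sum_congr rfl fun r _ => ?_
  rw [← mul_assoc, ← map_mul, mul_discriminantResultant k n r hn]

end BinaryForms

/-! Dehomogenize with y = 1 and let f = s ∏ (x - c_i) have distinct nonzero roots. Define u_i by
g(c_i) = u_i f'(c_i). As a resultant is a product over the roots of f, that of f and x (f' + t g)
is, up to sign, s^n ∏ c_i f'(c_i) (1 + u_i t). Dividing by a_0 a_n, the generating polynomial of the
discriminant-resultants at (f, g) is D ∏ (1 + u_i t), where D = s^(2n-2) ∏_{i ≠ j} (c_i - c_j) up to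
sign (`evalPair_discriminantResultant`). The degree of g is at most n - 2 exactly when ∑ u_i = 0, so
the coefficient of t vanishes; this is why index 1 is left out. There is no other constraint: over
an algebraically closed field the u_i realize any polynomial of degree at most n with constant term
1 and no linear term, and s adjusts D (`exists_evalPair_discriminantResultant`). Taking independent
transcendentals as values rules out any algebraic relation. -/

/-! ### Linear factors and resultants of split polynomials -/

open Polynomial in
/-- Over an algebraically closed field, a polynomial with constant term `1` is a product of linear
factors with constant term `1`. -/
lemma Polynomial.exists_eq_prod_one_add_C_mul_X {L : Type*} [Field L] [IsAlgClosed L] (n : ℕ)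
    (Q : L[X]) (h0 : Q.coeff 0 = 1) (hQ : Q.natDegree ≤ n) :
    ∃ u : Fin n → L, Q = ∏ i, (1 + C (u i) * X) := by
  induction n generalizing Q with
  | zero =>
    refine ⟨0, ?_⟩
    rw [eq_C_of_natDegree_le_zero hQ, h0]
    simp
  | succ n ih =>
    by_cases hd : Q.natDegree = 0
    · refine ⟨0, ?_⟩
      rw [eq_C_of_natDegree_le_zero hd.le, h0]
      simp
    obtain ⟨w, hw⟩ := IsAlgClosed.exists_root Q fun h =>
      hd (natDegree_eq_of_degree_eq_some h)
    obtain ⟨R, rfl⟩ := dvd_iff_isRoot.mpr hw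
    have hR : R ≠ 0 := by rintro rfl; simp at hd
    have hwR : -w * R.coeff 0 = 1 := by simpa [mul_coeff_zero] using h0
    have hw0 : w ≠ 0 := by rintro rfl; simp at hwR
    rw [natDegree_mul (X_sub_C_ne_zero w) hR, natDegree_X_sub_C] at hQ
    -- The root is nonzero, so X - w = -w (1 - w⁻¹ X); moving -w to the cofactor restores constant
    -- term 1.
    obtain ⟨u, hu⟩ := ih (C (-w) * R) (by rw [coeff_C_mul, hwR])
      ((natDegree_C_mul_le _ _).trans (by omega))
    refine ⟨Fin.cons (-w⁻¹) u, ?_⟩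
    have hC : (C w : L[X]) * C w⁻¹ = 1 := by rw [← C_mul, mul_inv_cancel₀ hw0, C_1]
    simp only [Fin.prod_univ_succ, Fin.cons_zero, Fin.cons_succ]
    rw [← hu, C_neg, C_neg]
    linear_combination (-R * X) * hC

-- Translates a vanishing linear coefficient into ∑ u_i = 0, the degree condition on the second
-- form.
open Polynomial in
lemma Polynomial.coeff_one_prod_one_add_C_mul_X {R ι : Type*} [CommRing R] (s : Finset ι)
    (u : ι → R) : (∏ i ∈ s, (1 + C (u i) * X)).coeff 1 = ∑ i ∈ s, u i := by
  classical
  have h0 : ∀ s : Finset ι, (∏ i ∈ s, (1 + C (u i) * X)).coeff 0 = 1 := fun s => by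
    simp [coeff_zero_eq_eval_zero, eval_prod]
  induction s using Finset.induction_on with
  | empty => simp [coeff_one]
  | insert i s hi ih =>
    rw [Finset.prod_insert hi, Finset.sum_insert hi, add_mul, one_mul, coeff_add, ih, mul_assoc,
      coeff_C_mul, coeff_X_mul, h0, mul_one, add_comm]

open Polynomial Lagrange in
/-- The resultant of a polynomial with known roots. -/
lemma Polynomial.resultant_C_mul_nodal {R : Type*} [CommRing R] [IsDomain R] (n m : ℕ) (s : R)
    (c : Fin n → R) (G : R[X]) (hG : G.natDegree ≤ m) :
    resultant (C s * nodal Finset.univ c) G n m = s ^ m * ∏ i, G.eval (c i) := by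
  have hs : (nodal Finset.univ c).Splits := by
    rw [nodal_eq]
    exact Splits.prod fun i _ => Splits.X_sub_C (c i)
  have hroots : (nodal Finset.univ c).roots = Finset.univ.val.map c := by
    rw [← roots_multiset_prod_X_sub_C (Finset.univ.val.map c), Multiset.map_map]
    rfl
  have h := resultant_eq_prod_eval (nodal Finset.univ c) G m hG hs
  rw [natDegree_nodal, Finset.card_univ, Fintype.card_fin, nodal_monic.leadingCoeff, one_pow,
    one_mul, hroots, Multiset.map_map] at h
  rw [resultant_C_mul_left, h]
  rfl

/-! ### Specialization at a pair of forms -/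

namespace BinaryForms

open Polynomial Lagrange

/-- A polynomial of degree at most `m` is the dehomogenization of the form with the same
coefficients. -/
lemma dehom_form_coeff {R : Type*} [CommRing R] (m : ℕ) (p : R[X]) (hp : p.natDegree ≤ m) :
    dehom (form m fun i => p.coeff i) = p := by
  rw [dehom_form, Fin.sum_univ_eq_sum_range (fun i => C (p.coeff i) * X ^ i) (m + 1)]
  exact (p.as_sum_range_C_mul_X_pow' (Nat.lt_succ_of_le hp)).symm

lemma map_dehom_form {R S : Type*} [CommRing R] [CommRing S] (φ : R →+* S) (m : ℕ)
    (c : Fin (m + 1) → R) :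
    (dehom (form m c)).map φ = dehom (form m fun i => φ (c i)) := by
  simp [dehom_form, Polynomial.map_sum]

/-- The evaluation of regular functions on `V_n × V_{n-2}` at a pair of dehomogenized forms. -/
noncomputable def evalPair (k : Type*) [Field k] (n : ℕ) {L : Type*} [Field L] [Algebra k L]
    (f g : L[X]) : CoordRing k n →ₐ[k] L :=
  MvPolynomial.aeval (Sum.elim (fun i => f.coeff i) fun j => g.coeff j)

section evalPair

variable {k : Type*} [Field k] {n : ℕ} {L : Type*} [Field L] [Algebra k L]

@[simp] lemma evalPair_a (f g : L[X]) (i : Fin (n + 1)) :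
    evalPair k n f g (a k n i) = f.coeff i := by
  simp [evalPair, a]

@[simp] lemma evalPair_b (f g : L[X]) (j : Fin (n - 2 + 1)) :
    evalPair k n f g (b k n j) = g.coeff j := by
  simp [evalPair, b]

/-- The Sylvester matrix has prescribed size, so its determinant commutes with specialization even
if leading coefficients vanish. The degree bounds ensure that the coordinates determine `f` and `g`.
-/
lemma map_totalRes (f g : L[X]) (hf : f.natDegree ≤ n) (hg : g.natDegree ≤ n - 2) :
    (totalRes k n).map (evalPair k n f g).toRingHom =
      (-1) ^ (n * n) *
        resultant (f.map C) (((derivative f).map C + C X * g.map C) * X) n n := by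
  have h1 : (dehom (genF k n)).map (mapRingHom (evalPair k n f g).toRingHom) = f.map C := by
    rw [genF, map_dehom_form, ← dehom_form_coeff n f hf, map_dehom_form]
    simp [dehom_form_coeff n f hf]
  have h2 : (dehom (genG k n)).map (mapRingHom (evalPair k n f g).toRingHom) = g.map C := by
    rw [genG, map_dehom_form, ← dehom_form_coeff _ g hg, map_dehom_form]
    simp [dehom_form_coeff _ g hg]
  rw [← coe_mapRingHom, totalRes, res, map_mul, ← resultant_map_map, h1, dehom_deformation,
    cofactor, Polynomial.map_mul, Polynomial.map_add, Polynomial.map_mul, ← derivative_map, h1, h2,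
    derivative_map, Polynomial.map_X, Polynomial.map_C, coe_mapRingHom, Polynomial.map_X]
  simp

variable (s : L) (c u : Fin n → L)

/-- The polynomial with values `s u_i ∏_{j ≠ i} (c_i - c_j)` at the nodes `c_i`. -/
noncomputable def residueForm : L[X] :=
  ∑ i, C (s * u i) * nodal (Finset.univ.erase i) c

/-- Each nodal factor is monic of degree n - 1, so the coefficient of x^(n-1) is s ∑ u_i. -/
lemma natDegree_residueForm (hu : ∑ i, u i = 0) :
    (residueForm s c u).natDegree ≤ n - 2 := by
  have hdeg : ∀ i, (nodal (Finset.univ.erase i) c).natDegree = n - 1 := fun i => by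
    rw [natDegree_nodal, Finset.card_erase_of_mem (Finset.mem_univ i), Finset.card_univ,
      Fintype.card_fin]
  have h1 : (residueForm s c u).natDegree ≤ n - 1 :=
    natDegree_sum_le_of_forall_le _ _ fun i _ =>
      (natDegree_C_mul_le _ _).trans (hdeg i).le
  have h2 : (residueForm s c u).coeff (n - 1) = 0 := by
    have hc : ∀ i, (nodal (Finset.univ.erase i) c).coeff (n - 1) = 1 := fun i => by
      rw [← hdeg i]
      exact nodal_monic.coeff_natDegree
    simp only [residueForm, finsetSum_coeff, coeff_C_mul, hc, mul_one, ← Finset.mul_sum, hu, mul_zero]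
  exact natDegree_le_pred h1 h2

lemma eval_residueForm (i : Fin n) :
    (residueForm s c u).eval (c i) =
      s * u i * (nodal (Finset.univ.erase i) c).eval (c i) := by
  rw [residueForm, eval_finsetSum, Finset.sum_eq_single i]
  · simp
  · intro j _ hj
    rw [eval_mul, eval_nodal_at_node (Finset.mem_erase.mpr ⟨hj.symm, Finset.mem_univ i⟩), mul_zero]
  · simp

/-- At the root c_i of f the second argument equals c_i f'(c_i) (1 + u_i t). One factor s^n comes
from the leading coefficient of f, another from the values f'(c_i). -/
lemma resultant_nodal_residueForm (hn : 2 ≤ n) (hu : ∑ i, u i = 0) :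
    resultant ((C s * nodal Finset.univ c).map C)
      (((derivative (C s * nodal Finset.univ c)).map C +
        C X * (residueForm s c u).map C) * X) n n =
      C (s ^ (2 * n) * (∏ i, c i) * ∏ i, (nodal (Finset.univ.erase i) c).eval (c i)) *
        ∏ i, (1 + C (u i) * X) := by
  have hmap : (C s * nodal Finset.univ c).map (C : L →+* L[X]) =
      C (C s) * nodal Finset.univ fun i => C (c i) := by
    simp [nodal_eq, Polynomial.map_prod]
  have hdeg : (C s * nodal Finset.univ c).natDegree ≤ n :=
    (natDegree_C_mul_le _ _).trans (by simp [natDegree_nodal])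
  rw [hmap, resultant_C_mul_nodal]
  · have he : ∀ i, eval (C (c i)) (((derivative (C s * nodal Finset.univ c)).map C +
        C X * (residueForm s c u).map C) * X) =
        C (s * c i * (nodal (Finset.univ.erase i) c).eval (c i)) * (1 + C (u i) * X) := fun i => by
      have hd : (derivative (C s * nodal Finset.univ c)).eval (c i) =
          s * (nodal (Finset.univ.erase i) c).eval (c i) := by
        rw [derivative_C_mul, eval_mul, eval_C,
          eval_nodal_derivative_eval_node_eq (Finset.mem_univ i)]
      simp only [eval_mul, eval_add, eval_X, eval_C, eval_map_apply, hd, eval_residueForm, C_mul]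
      ring
    simp only [he, Finset.prod_mul_distrib, C_mul, Finset.prod_const, Finset.card_univ,
      Fintype.card_fin, map_prod, map_pow]
    ring
  · refine natDegree_mul_le.trans ?_
    rw [natDegree_X]
    have h : ((derivative (C s * nodal Finset.univ c)).map C +
        C X * (residueForm s c u).map C : L[X][X]).natDegree ≤ n - 1 := by
      refine natDegree_add_le_of_degree_le ?_ ?_
      · exact natDegree_map_le.trans ((natDegree_derivative_le _).trans
          (Nat.sub_le_sub_right hdeg 1))
      · refine (natDegree_C_mul_le _ _).trans (natDegree_map_le.trans
          ((natDegree_residueForm s c u hu).trans (by omega)))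
    omega

/-- The discriminant-resultants at a pair of forms given by the roots of the first one and by the
residues of their quotient. -/
lemma evalPair_discriminantResultant (hn : 2 ≤ n) (hs : s ≠ 0) (hc : ∀ i, c i ≠ 0)
    (hu : ∑ i, u i = 0) (r : ℕ) :
    evalPair k n (C s * nodal Finset.univ c) (residueForm s c u) (discriminantResultant k n r) =
      (-1) ^ (n * n + n) * s ^ (2 * n - 2) *
        (∏ i, (nodal (Finset.univ.erase i) c).eval (c i)) *
        (∏ i, (1 + C (u i) * X)).coeff r := by
  have hdeg : (C s * nodal Finset.univ c).natDegree ≤ n :=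
    (natDegree_C_mul_le _ _).trans (by simp [natDegree_nodal])
  have h0 : (C s * nodal Finset.univ c).coeff 0 = s * ((-1) ^ n * ∏ i, c i) := by
    rw [coeff_C_mul, coeff_zero_eq_eval_zero, eval_nodal]
    simp [Finset.prod_neg]
  have hl : (C s * nodal Finset.univ c).coeff n = s := by
    have h := (nodal_monic (s := Finset.univ) (v := c)).coeff_natDegree
    rw [natDegree_nodal, Finset.card_univ, Fintype.card_fin] at h
    rw [coeff_C_mul, h, mul_one]
  have h := congrArg (evalPair k n (C s * nodal Finset.univ c) (residueForm s c u))
    (mul_discriminantResultant k n r hn)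
  have ht := congrArg (fun p => coeff p r) (map_totalRes (k := k) _ _ hdeg
    (natDegree_residueForm s c u hu))
  rw [resultant_nodal_residueForm s c u hn hu] at ht
  simp only [coeff_map] at ht
  rw [show ((-1) ^ (n * n) : L[X]) = C ((-1) ^ (n * n)) by simp, coeff_C_mul, coeff_C_mul] at ht
  rw [map_mul, map_mul, evalPair_a, evalPair_a, Fin.val_zero, Fin.val_last, h0, hl] at h
  replace h := h.trans ht
  have hP : ∏ i, c i ≠ 0 := Finset.prod_ne_zero_iff.mpr fun i _ => hc i
  -- The specialized a_0 a_n is s (-1)^n ∏ c_i times s; it is nonzero and can be cancelled, which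
  -- turns s^(2n) into s^(2n-2).
  have h1 : ((-1 : L) ^ n) * (-1) ^ n = 1 := by rw [← mul_pow]; simp
  refine mul_left_cancel₀ (mul_ne_zero (mul_ne_zero hs (mul_ne_zero
    (pow_ne_zero n (neg_ne_zero.mpr one_ne_zero)) hP)) hs) (h.trans ?_)
  rw [show 2 * n = 2 * n - 2 + 2 by omega, pow_add s, pow_add (-1 : L), Nat.add_sub_cancel]
  linear_combination (-(-1) ^ (n * n) * s ^ (2 * n - 2) * s ^ 2 * (∏ i, c i) *
    (∏ i, (nodal (Finset.univ.erase i) c).eval (c i)) * (∏ i, (1 + C (u i) * X)).coeff r) * h1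

end evalPair

/-! ### Prescribing the values -/

/-- Over an algebraically closed field, the discriminant-resultants with index different from `1`
take arbitrary values, provided that the discriminant is not zero. -/
lemma exists_evalPair_discriminantResultant (k : Type*) [Field k] {L : Type*} [Field L]
    [IsAlgClosed L] [CharZero L] [Algebra k L] (n : ℕ) (hn : 2 ≤ n) (p : ℕ → L) (h0 : p 0 ≠ 0)
    (h1 : p 1 = 0) :
    ∃ f g : L[X], ∀ r ≤ n, evalPair k n f g (discriminantResultant k n r) = p r := by
  set Q : L[X] := ∑ r ∈ Finset.range (n + 1), C (p r / p 0) * X ^ r with hQ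
  have hcoeff : ∀ r ≤ n, Q.coeff r = p r / p 0 := fun r hr => by
    simp [hQ, finsetSum_coeff, Nat.lt_succ_of_le hr]
  have hdeg : Q.natDegree ≤ n := natDegree_sum_le_of_forall_le _ _ fun r hr =>
    (natDegree_C_mul_X_pow_le _ _).trans (Nat.lt_succ_iff.mp (Finset.mem_range.mp hr))
  obtain ⟨u, hu⟩ := exists_eq_prod_one_add_C_mul_X n Q
    (by rw [hcoeff 0 (Nat.zero_le n), div_self h0]) hdeg
  have hsum : ∑ i, u i = 0 := by
    rw [← coeff_one_prod_one_add_C_mul_X, ← hu, hcoeff 1 (by omega), h1, zero_div]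
  -- Any distinct nonzero nodes would do; in characteristic zero 1, …, n are such.
  let c : Fin n → L := fun i => ((i : ℕ) + 1 : ℕ)
  have hc : ∀ i, c i ≠ 0 := fun i => Nat.cast_ne_zero.mpr (Nat.succ_ne_zero _)
  have hinj : Function.Injective c := fun i j hij => by
    have h : (i : ℕ) + 1 = j + 1 := Nat.cast_injective hij
    exact Fin.ext (by omega)
  set D : L := ∏ i, (nodal (Finset.univ.erase i) c).eval (c i) with hD
  have hD0 : D ≠ 0 := Finset.prod_ne_zero_iff.mpr fun i _ =>
    eval_nodal_not_at_node fun j hj h => (Finset.mem_erase.mp hj).1 (hinj h).symm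
  have he : ((-1 : L) ^ (n * n + n)) ≠ 0 := pow_ne_zero _ (neg_ne_zero.mpr one_ne_zero)
  -- `Q` fixes the values only up to the common factor `p 0`; this choice of the leading coefficient
  -- supplies it.
  obtain ⟨s, hs⟩ := IsAlgClosed.exists_pow_nat_eq (p 0 / ((-1) ^ (n * n + n) * D))
    (show 0 < 2 * n - 2 by omega)
  have hs0 : s ≠ 0 := by
    rintro rfl
    rw [zero_pow (by omega)] at hs
    exact div_ne_zero h0 (mul_ne_zero he hD0) hs.symm
  refine ⟨C s * nodal Finset.univ c, residueForm s c u, fun r hr => ?_⟩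
  rw [evalPair_discriminantResultant s c u hn hs0 hc hsum, ← hu, hcoeff r hr, hs, ← hD]
  field_simp

end BinaryForms

theorem theorem5 {k : Type*} [Field k] [CharZero k] (n : ℕ) (hn : 2 ≤ n) :
    AlgebraicIndependent k
      (fun r : {r : ℕ // r ≤ n ∧ r ≠ 1} => BinaryForms.discriminantResultant k n r) := by
  let A := MvPolynomial {r : ℕ // r ≤ n ∧ r ≠ 1} k
  let L := AlgebraicClosure (FractionRing A)
  have hinj : Function.Injective (algebraMap A L) := by
    rw [IsScalarTower.algebraMap_eq A (FractionRing A) L]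
    exact (algebraMap (FractionRing A) L).injective.comp (IsFractionRing.injective A _)
  have : CharZero L := charZero_of_injective_algebraMap (algebraMap k L).injective
  have hX : AlgebraicIndependent k fun r => algebraMap A L (MvPolynomial.X r) :=
    (MvPolynomial.algebraicIndependent_X _ k).map' (f := IsScalarTower.toAlgHom k A L) hinj
  -- The target values are the independent variables themselves, with the forced value 0 at index 1.
  let p : ℕ → L := fun r =>
    if h : r ≤ n ∧ r ≠ 1 then algebraMap A L (MvPolynomial.X ⟨r, h⟩) else 0
  have hp : ∀ r : {r : ℕ // r ≤ n ∧ r ≠ 1}, p r = algebraMap A L (MvPolynomial.X r) :=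
    fun r => dif_pos r.2
  obtain ⟨f, g, hfg⟩ := BinaryForms.exists_evalPair_discriminantResultant k n hn p
    (by rw [hp ⟨0, Nat.zero_le n, zero_ne_one⟩]; exact hX.ne_zero _)
    (dif_neg fun h => h.2 rfl)
  -- A relation between the discriminant-resultants would specialize to one between the variables.
  refine AlgebraicIndependent.of_comp (BinaryForms.evalPair k n f g) ?_
  have he : (BinaryForms.evalPair k n f g ∘ fun r : {r : ℕ // r ≤ n ∧ r ≠ 1} =>
      BinaryForms.discriminantResultant k n r) = fun r => algebraMap A L (MvPolynomial.X r) :=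
    funext fun r => (hfg r r.2.1).trans (hp r)
  rw [he]
  exact hX
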